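/- Let $M$ be a connected, complete, $m$-dimensional smooth Riemannian manifold with Riemannian distance $\mathrm d$ and closed balls $\mathbb B(p,r)=\{q:\mathrm d(p,q)\le r\}$. Let $n\ge 1$, $I=\{1,\dots,n\}$, and let $F=(f_i)_{i\in I}:M\to\mathbb R^n$ be continuously differentiable. A point $p$ is a *weak Pareto optimum* of $\min_M F$ if there is no $q\in M$ with $f_i(q)<f_i(p)$ for all $i\in I$, and *Pareto critical* if there is no $v\in T_pM$ with $\langle\nabla f_i(p),v\rangle<0$ for all $i\in I$. Put $$\alpha_p(v)=\max_{i\in I}\langle\nabla f_i(p),v\rangle+\tfrac12\|v\|^2\ (v\in T_pM),\qquad v(p)=\operatorname{argmin}_{v\in T_pM}\alpha_p(v),\qquad \varphi(p)=\sup_{q\in M}\min_{i\in I}\,(f_i(p)-f_i(q)).$$ *Algorithm* (parameters $\sigma,\beta\in(0,1)$, $R\ge1$, starting point $p_0\in M$). If $p_k$ is Pareto critical, stop. Otherwise choose $v_k\in T_{p_k}M$ with $\alpha_{p_k}(v_k)\le(1-\sigma)\,\alpha_{p_k}(v(p_k))$, let $\gamma_k$ be the geodesic with $\gamma_k(0)=p_k$,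 $\gamma_k'(0)=v_k$, choose $t_k\in(0,R]$ with $$f_i(\gamma_k(t_k))\le f_i(p_k)+\beta t_k\langle\nabla f_i(p_k),v_k\rangle\quad\text{for all } i\in I,$$ and set $p_{k+1}=\gamma_k(t_k)$. If the algorithm stops at $p_N$, put $p_k=p_N$ for $k>N$; the step sizes are then only $t_0,\dots,t_{N-1}$. **Theorem.** Fix $\sigma,\beta\in(0,1)$ and $R\ge1$. Let $\bar p\in M$ be a weak Pareto optimum, and suppose that for some $\alpha>0$ and $r>0$ $$\|v(p)\|^2\ge\alpha\,\varphi(p)\quad\text{for all }p\in\mathbb B(\bar p,r).$$ Then there is $\delta>0$ such that every sequence $(p_k)$ generated by the algorithm with these parameters from a point $p_0\in\mathbb B(\bar p,\delta)$, whose step sizes satisfy $\underline t:=\inf_k t_k>0$ (where $\inf\emptyset=+\infty$), stays in $\mathbb B(\bar p,r)$ and converges linearly to a weak Pareto optimum $p^*$, that is, $p_k\to p^*$ and there are $C\in\mathbb R$ and $\theta\in[0,1)$ with $\mathrm d(p_k,p^*)\le C\theta^k$ for all $k$. Moreover, if $p_0$ is not Pareto critical (so that at least one step is made), then $1-\frac{\alpha\beta\underline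 t(1-\sqrt\sigma)^2}{2}\ge0$, and with $$\rho:=\sqrt{1-\frac{\alpha\beta\underline t(1-\sqrt\sigma)^2}{2}}<1,\qquad \mu:=\frac{2R}{(1-\rho)^2\beta},$$ one has $$\mathrm d^2(p_k,p^*)\le\mu\,\varphi(p_k)\le\mu\,\rho^{2k}\varphi(p_0)\quad\text{for all }k\ge0.$$ -/

import Mathlib

open Set Filter Topology Manifold Bundle
open scoped ContDiff

noncomputable section

namespace MultiobjDescent

/-! Geodesics of a Riemannian manifold, through the geodesic equation of the Levi-Civita connection
in coordinates. -/

section Geodesic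

variable (m : ℕ) {M : Type*} [MetricSpace M] [ChartedSpace (EuclideanSpace ℝ (Fin m)) M]
  [RiemannianBundle (fun x : M => TangentSpace (𝓡 m) x)]

/-- The metric in the chart around `x₀`: the value `g_y(u, w)` at the coordinate point `y` is the
inner product of the images of `u`, `w` under the differential of the inverse chart. -/
def chartMetric (x₀ : M) (y u w : EuclideanSpace ℝ (Fin m)) : ℝ :=
  inner ℝ (mfderiv (𝓡 m) (𝓡 m) (extChartAt (𝓡 m) x₀).symm y u :
      TangentSpace (𝓡 m) ((extChartAt (𝓡 m) x₀).symm y))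
    (mfderiv (𝓡 m) (𝓡 m) (extChartAt (𝓡 m) x₀).symm y w :
      TangentSpace (𝓡 m) ((extChartAt (𝓡 m) x₀).symm y))

/-- The Christoffel symbols of the first kind of the Levi-Civita connection in the chart around
`x₀`, that is, `g(∇_u v, w)` for constant coordinate fields `u`, `v`, `w`:
`Γ(u, v; w) = (∂_u g(v, w) + ∂_v g(u, w) - ∂_w g(u, v)) / 2`. -/
def chartChristoffel (x₀ : M) (y u v w : EuclideanSpace ℝ (Fin m)) : ℝ :=
  (fderiv ℝ (fun z => chartMetric m x₀ z v w) y u + fderiv ℝ (fun z => chartMetric m x₀ z u w) y v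
    - fderiv ℝ (fun z => chartMetric m x₀ z u v) y w) / 2

/-- `γ : ℝ → M` is a geodesic: it is smooth and `∇_{γ'} γ' = 0`. In every chart, with `c` the
coordinate expression of `γ`, the equation reads `g(c'', w) + Γ(c', c'; w) = 0` for all `w`
(the usual equation `c''^k + Γ^k_{ij} c'^i c'^j = 0` with the index `k` lowered by the metric). -/
def IsGeodesic (γ : ℝ → M) : Prop :=
  ContMDiff 𝓘(ℝ, ℝ) (𝓡 m) ∞ γ ∧
    ∀ (x₀ : M) (t : ℝ), γ t ∈ (chartAt (EuclideanSpace ℝ (Fin m)) x₀).source →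
      ∀ w : EuclideanSpace ℝ (Fin m),
        chartMetric m x₀ (extChartAt (𝓡 m) x₀ (γ t))
            (deriv (deriv fun s => extChartAt (𝓡 m) x₀ (γ s)) t) w
          + chartChristoffel m x₀ (extChartAt (𝓡 m) x₀ (γ t))
              (deriv (fun s => extChartAt (𝓡 m) x₀ (γ s)) t)
              (deriv (fun s => extChartAt (𝓡 m) x₀ (γ s)) t) w = 0

end Geodesic

section Problem

variable (m : ℕ) {n : ℕ} {M : Type*} [MetricSpace M] [ChartedSpace (EuclideanSpace ℝ (Fin m)) M]

/-- `p` is a weak Pareto optimum of `F = (f_i)`: there is no `q` with `F(q) ≺ F(p)`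
and `F(q) ≠ F(p)`. -/
def IsWeakPareto {n : ℕ} {M : Type*} (f : Fin n → M → ℝ) (p : M) : Prop :=
  ¬ ∃ q : M, (∀ i, f i q < f i p) ∧ (fun i => f i q) ≠ (fun i => f i p)

/-- The merit function `φ(p) = sup_q min_i (f_i(p) - f_i(q))`. The supremum is finite at every `p`
as soon as a weak Pareto optimum exists. -/
def merit {n : ℕ} [NeZero n] {M : Type*} (f : Fin n → M → ℝ) (p : M) : ℝ :=
  ⨆ q : M, Finset.univ.inf' Finset.univ_nonempty fun i => f i p - f i q

/-- The Jacobian: `JF(p)(v) = (⟨∇f_i(p), v⟩)_i`, where `⟨∇f_i(p), v⟩` is the differential of `f_i`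
at `p` applied to `v`. -/
def jac (f : Fin n → M → ℝ) (p : M) (v : TangentSpace (𝓡 m) p) (i : Fin n) : ℝ :=
  mvfderiv (𝓡 m) (f i) p v

/-- Pareto critical points: the image of `JF(p)` contains no vector with all entries negative. -/
def IsParetoCritical (f : Fin n → M → ℝ) (p : M) : Prop :=
  ¬ ∃ v : TangentSpace (𝓡 m) p, ∀ i, jac m f p v i < 0

variable [NeZero n] [RiemannianBundle (fun x : M => TangentSpace (𝓡 m) x)]

/-- The function `α_p(v) = max_i ⟨∇f_i(p), v⟩ + ‖v‖² / 2` on the tangent space at `p`. -/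
def descentModel (f : Fin n → M → ℝ) (p : M) (v : TangentSpace (𝓡 m) p) : ℝ :=
  Finset.univ.sup' Finset.univ_nonempty (jac m f p v) + ‖v‖ ^ 2 / 2

theorem exists_descentModel_min (f : Fin n → M → ℝ) (p : M) :
    ∃ v : TangentSpace (𝓡 m) p, ∀ w, descentModel m f p v ≤ descentModel m f p w := by
  have : FiniteDimensional ℝ (TangentSpace (𝓡 m) p) :=
    inferInstanceAs (FiniteDimensional ℝ (EuclideanSpace ℝ (Fin m)))
  have : ProperSpace (TangentSpace (𝓡 m) p) := FiniteDimensional.proper ℝ _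
  have hcont : Continuous fun v : TangentSpace (𝓡 m) p => descentModel m f p v := by
    unfold descentModel
    refine Continuous.add ?_ (by fun_prop)
    refine Continuous.finset_sup'_apply _ fun i _ => ?_
    exact (mvfderiv (𝓡 m) (f i) p).continuous
  let i₀ : Fin n := 0
  set C := ‖mvfderiv (𝓡 m) (f i₀) p‖ with hC
  have hlow : ∀ v : TangentSpace (𝓡 m) p, ‖v‖ * (‖v‖ / 2 - C) ≤ descentModel m f p v := by
    intro v
    have h1 : jac m f p v i₀ ≤ Finset.univ.sup' Finset.univ_nonempty (jac m f p v) :=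
      Finset.le_sup' (jac m f p v) (Finset.mem_univ i₀)
    have h2 : |jac m f p v i₀| ≤ C * ‖v‖ := (mvfderiv (𝓡 m) (f i₀) p).le_opNorm v
    have h3 := neg_le_of_abs_le h2
    unfold descentModel
    nlinarith
  have hlim : Tendsto (fun v : TangentSpace (𝓡 m) p => descentModel m f p v)
      (cocompact _) atTop := by
    refine tendsto_atTop_mono hlow ?_
    have hn := tendsto_norm_cocompact_atTop (E := TangentSpace (𝓡 m) p)
    refine Tendsto.atTop_mul_atTop₀ hn ?_
    exact tendsto_atTop_add_const_right _ (-C) (hn.atTop_div_const (by norm_num))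
  exact hcont.exists_forall_le hlim

/-- The steepest descent direction `v(p)`, the minimizer of `α_p` (it is unique, `α_p` being
strongly convex). -/
def steepestDescent (f : Fin n → M → ℝ) (p : M) : TangentSpace (𝓡 m) p :=
  (exists_descentModel_min m f p).choose

/-- `v ∈ D_σ(p)`: the vector `v` is a `σ`-approximate steepest descent direction at `p`, that is,
`α_p(v) ≤ (1 - σ) α_p(v(p))`. -/
def IsApproxSteepest (f : Fin n → M → ℝ) (σ : ℝ) (p : M) (v : TangentSpace (𝓡 m) p) : Prop :=
  descentModel m f p v ≤ (1 - σ) * descentModel m f p (steepestDescent m f p)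

/-- One step of the inexact descent algorithm with parameters `σ`, `β`, `R`, from `p` to `p'`
with direction `v` and step size `t`, along the geodesic `γ` with `γ(0) = p` and `γ'(0) = v`. -/
def IsStep (f : Fin n → M → ℝ) (σ β R : ℝ) (p : M) (v : TangentSpace (𝓡 m) p) (t : ℝ)
    (p' : M) : Prop :=
  IsApproxSteepest m f σ p v ∧ t ∈ Ioc 0 R ∧
    ∃ γ : ℝ → M, IsGeodesic m γ ∧
      (⟨γ 0, mfderiv 𝓘(ℝ, ℝ) (𝓡 m) γ 0 (1 : ℝ)⟩ : TangentBundle (𝓡 m) M) = ⟨p, v⟩ ∧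
      (∀ i, f i (γ t) ≤ f i p + β * t * jac m f p v i) ∧
      p' = γ t

/-- `(p_k)`, with directions `(v_k)` and step sizes `(t_k)`, is generated by the algorithm. If the
algorithm stops at a Pareto critical `p_k`, the sequence is continued by the constant `p_k`, and
`v_j`, `t_j` have no meaning for `j ≥ k`. -/
def IsGenerated (f : Fin n → M → ℝ) (σ β R : ℝ) (p : ℕ → M)
    (v : ∀ k, TangentSpace (𝓡 m) (p k)) (t : ℕ → ℝ) : Prop :=
  ∀ k, (IsParetoCritical m f (p k) → p (k + 1) = p k) ∧
    (¬ IsParetoCritical m f (p k) → IsStep m f σ β R (p k) (v k) (t k) (p (k + 1)))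

/-- The infimum of the step sizes `t_k` over the steps that the algorithm performs. -/
def stepInf (f : Fin n → M → ℝ) (p : ℕ → M) (t : ℕ → ℝ) : ℝ :=
  ⨅ k : {k : ℕ // ¬ IsParetoCritical m f (p k)}, t k

end Problem

/-- Linear convergence of `(x_k)` to `x`: `d(x_k, x)` is dominated by a geometric sequence of
ratio less than one. -/
def ConvergesLinearly {X : Type*} [MetricSpace X] (x : ℕ → X) (a : X) : Prop :=
  Tendsto x atTop (𝓝 a) ∧ ∃ C θ : ℝ, 0 ≤ θ ∧ θ < 1 ∧ ∀ k, dist (x k) a ≤ C * θ ^ k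

/-- The rate `ρ = √(1 - α β τ (1 - √σ)² / 2)`. -/
def rate (α β σ τ : ℝ) : ℝ := √(1 - α * β * τ * (1 - √σ) ^ 2 / 2)

/-- The constant `μ = 2 R / ((1 - ρ)² β)`. -/
def distConst (R β ρ : ℝ) : ℝ := 2 * R / ((1 - ρ) ^ 2 * β)

end MultiobjDescent

end

/-! Let `J(v) = max_i ⟨∇f_i(p), v⟩`. Optimality of `v(p)` along its ray gives `α_p(v(p)) =
-‖v(p)‖²/2`, and `α_p` is strongly convex. So an admissible direction `v` satisfies `‖v‖ ≥ (1 -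
√σ)‖v(p)‖` and `J(v) ≤ -‖v‖²/2`. The line search then lowers every `f_i`, hence `φ`, by at least
`βt‖v‖²/2` (`IsStep.merit_add_le`). With `‖v(p)‖² ≥ αφ(p)` this is the contraction `φ(p_{k+1}) ≤
ρ²φ(p_k)`.

Geodesics have constant speed, so a step has length at most `t‖v‖`, which is bounded in two ways.
Through `t ≤ R` it is at most `√(2Rφ(p_k)/β)`; the resulting geometric series gives the limit and
`μ`. Through the error bound it is at most `K(√φ(p_k) - √φ(p_{k+1}))` with `K` independent of `t`.
This telescopes and confines the sequence to the ball, with `δ` chosen before the step sizes are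
known. -/

noncomputable section

namespace MultiobjDescent

/-! ### Constant speed of geodesics. -/

section Speed

variable {m : ℕ} {M : Type*} [MetricSpace M] [ChartedSpace (EuclideanSpace ℝ (Fin m)) M]

local notation "𝔼" => EuclideanSpace ℝ (Fin m)

/-- All tangent spaces are the same type, but the norm depends on the base point; moving in the
total space keeps track of it. -/
theorem tangentBundle_mk_congr {x y : M} (h : x = y) (u : 𝔼) :
    (⟨x, u⟩ : TangentBundle (𝓡 m) M) = ⟨y, u⟩ := by
  subst h; rfl

section

variable [RiemannianBundle (fun x : M => TangentSpace (𝓡 m) x)]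

theorem chartMetric_add_left (x₀ : M) (y u u' w : 𝔼) :
    chartMetric m x₀ y (u + u') w = chartMetric m x₀ y u w + chartMetric m x₀ y u' w :=
  (congrArg (fun a => inner ℝ a (mfderiv (𝓡 m) (𝓡 m) (extChartAt (𝓡 m) x₀).symm y w))
    (map_add (mfderiv (𝓡 m) (𝓡 m) (extChartAt (𝓡 m) x₀).symm y) u u')).trans
    (inner_add_left _ _ _)

theorem chartMetric_smul_left (x₀ : M) (y u w : 𝔼) (a : ℝ) :
    chartMetric m x₀ y (a • u) w = a * chartMetric m x₀ y u w :=
  (congrArg (fun a => inner ℝ a (mfderiv (𝓡 m) (𝓡 m) (extChartAt (𝓡 m) x₀).symm y w))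
    (map_smul (mfderiv (𝓡 m) (𝓡 m) (extChartAt (𝓡 m) x₀).symm y) a u)).trans
    (real_inner_smul_left _ _ _)

theorem chartMetric_symm (x₀ : M) (y u w : 𝔼) :
    chartMetric m x₀ y u w = chartMetric m x₀ y w u := by
  unfold chartMetric
  rw [real_inner_comm]

end

variable [IsManifold (𝓡 m) ∞ M]

/-- The differential of the inverse chart, as a map into the tangent bundle, is smooth. -/
theorem contMDiffAt_mfderiv_extChartAt_symm (x₀ : M) {z₀ : 𝔼 × 𝔼}
    (hz₀ : z₀.1 ∈ (extChartAt (𝓡 m) x₀).target) :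
    ContMDiffAt 𝓘(ℝ, 𝔼 × 𝔼) ((𝓡 m).prod 𝓘(ℝ, 𝔼)) 1
      (fun z : 𝔼 × 𝔼 => (⟨(extChartAt (𝓡 m) x₀).symm z.1,
        mfderiv (𝓡 m) (𝓡 m) (extChartAt (𝓡 m) x₀).symm z.1 z.2⟩ : TangentBundle (𝓡 m) M)) z₀ := by
  have : IsManifold (𝓡 m) 1 M := IsManifold.of_le (n := ∞) (by norm_cast)
  have : IsManifold (𝓡 m) (1 + 1) M := IsManifold.of_le (n := ∞) (by norm_cast)
  set e := trivializationAt 𝔼 (TangentSpace (𝓡 m)) x₀ with he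
  have htarget : (extChartAt (𝓡 m) x₀).target ∈ 𝓝 z₀.1 :=
    (isOpen_extChartAt_target x₀).mem_nhds hz₀
  have hsrc : ∀ y ∈ (extChartAt (𝓡 m) x₀).target,
      (extChartAt (𝓡 m) x₀).symm y ∈ (chartAt 𝔼 x₀).source := fun y hy => by
    simpa using (extChartAt (𝓡 m) x₀).map_target hy
  have h1 : ContMDiffAt 𝓘(ℝ, 𝔼 × 𝔼) ((𝓡 m).prod 𝓘(ℝ, 𝔼)) 1
      (fun z : 𝔼 × 𝔼 => (((extChartAt (𝓡 m) x₀).symm z.1, z.2) : M × 𝔼)) z₀ := by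
    refine ContMDiffAt.prodMk ?_ contDiff_snd.contMDiff.contMDiffAt
    exact ((contMDiffOn_extChartAt_symm x₀).contMDiffAt htarget).comp z₀
      contDiff_fst.contMDiff.contMDiffAt
  have h2 : ContMDiffAt ((𝓡 m).prod 𝓘(ℝ, 𝔼)) ((𝓡 m).prod 𝓘(ℝ, 𝔼)) 1
      e.toOpenPartialHomeomorph.symm ((extChartAt (𝓡 m) x₀).symm z₀.1, z₀.2) := by
    refine (e.contMDiffOn_symm (n := 1) (IB := 𝓡 m)).contMDiffAt
      (e.open_target.mem_nhds ?_)
    rw [e.mem_target]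
    simpa [he] using hsrc _ hz₀
  refine (h2.comp z₀ h1).congr_of_eventuallyEq ?_
  filter_upwards [continuousAt_fst.preimage_mem_nhds htarget] with z hz
  have hz' := hsrc _ hz
  -- Over the chart domain the inverse trivialization is the differential of the inverse chart, so
  -- its smoothness transfers.
  have h3 := TangentBundle.symmL_trivializationAt (I := 𝓡 m) hz'
  rw [(extChartAt (𝓡 m) x₀).right_inv hz] at h3
  simp only [Function.comp]
  have h4 := e.mk_symm (b := (extChartAt (𝓡 m) x₀).symm z.1) (by simpa [he] using hz') z.2
  rw [← h4]
  congr 1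
  have h5 : mfderiv (𝓡 m) (𝓡 m) (extChartAt (𝓡 m) x₀).symm z.1
      = mfderivWithin (𝓡 m) (𝓡 m) (extChartAt (𝓡 m) x₀).symm (range (𝓡 m)) z.1 := by
    rw [ModelWithCorners.range_eq_univ, mfderivWithin_univ]
  rw [h5, ← h3]
  exact e.symmL_apply (by simpa [he] using hz') z.2

variable [RiemannianBundle (fun x : M => TangentSpace (𝓡 m) x)]
  [IsContMDiffRiemannianBundle (𝓡 m) ∞ (EuclideanSpace ℝ (Fin m))
      (fun x : M => TangentSpace (𝓡 m) x)]

theorem differentiableAt_chartMetric_self (x₀ : M) {z₀ : 𝔼 × 𝔼}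
    (hz₀ : z₀.1 ∈ (extChartAt (𝓡 m) x₀).target) :
    DifferentiableAt ℝ (fun z : 𝔼 × 𝔼 => chartMetric m x₀ z.1 z.2 z.2) z₀ := by
  have : IsContMDiffRiemannianBundle (𝓡 m) 1 𝔼 (fun x : M => TangentSpace (𝓡 m) x) :=
    IsContMDiffRiemannianBundle.of_le (n := ∞) (by norm_cast)
  have h := contMDiffAt_mfderiv_extChartAt_symm x₀ hz₀
  have h2 := ContMDiffAt.inner_bundle (F := 𝔼) (E := fun x : M => TangentSpace (𝓡 m) x) h h
  exact h2.contDiffAt.differentiableAt (by simp)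

/-- The derivative of the square of the speed of a curve, in a chart. -/
theorem hasDerivAt_chartMetric_self (x₀ : M) {c c' : ℝ → 𝔼} {a b : 𝔼} {t : ℝ}
    (ht : c t ∈ (extChartAt (𝓡 m) x₀).target) (hc : HasDerivAt c a t) (hc' : HasDerivAt c' b t) :
    HasDerivAt (fun s => chartMetric m x₀ (c s) (c' s) (c' s))
      (fderiv ℝ (fun z => chartMetric m x₀ z (c' t) (c' t)) (c t) a
        + 2 * chartMetric m x₀ (c t) b (c' t)) t := by
  have hG := (differentiableAt_chartMetric_self x₀ (z₀ := (c t, c' t)) ht).hasFDerivAt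
  set D := fderiv ℝ (fun z : 𝔼 × 𝔼 => chartMetric m x₀ z.1 z.2 z.2) (c t, c' t) with hD
  have hmain := hG.comp_hasDerivAt t (hc.prodMk hc')
  -- The total derivative splits as `D (a, 0) + D (0, b)`; the second term is read off from a
  -- quadratic polynomial in `s`.
  have hfst : HasFDerivAt (fun z => chartMetric m x₀ z (c' t) (c' t))
      (D.comp (ContinuousLinearMap.inl ℝ 𝔼 𝔼)) (c t) :=
    HasFDerivAt.comp (g := fun z : 𝔼 × 𝔼 => chartMetric m x₀ z.1 z.2 z.2)
      (f := fun z => (z, c' t)) (c t) hG (hasFDerivAt_prodMk_left (c t) (c' t))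
  have hsnd : HasDerivAt (fun s : ℝ => chartMetric m x₀ (c t) (c' t + s • b) (c' t + s • b))
      (D (0, b)) 0 := by
    have h0 : HasDerivAt (fun s : ℝ => (c t, c' t + s • b)) (0, b) 0 := by
      refine (hasDerivAt_const _ _).prodMk ?_
      simpa using ((hasDerivAt_id (0 : ℝ)).smul_const b).const_add (c' t)
    exact HasFDerivAt.comp_hasDerivAt (0 : ℝ) (by simpa using hG) h0
  have hsnd' : HasDerivAt (fun s : ℝ => chartMetric m x₀ (c t) (c' t + s • b) (c' t + s • b))
      (2 * chartMetric m x₀ (c t) b (c' t)) 0 := by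
    have heq : (fun s : ℝ => chartMetric m x₀ (c t) (c' t + s • b) (c' t + s • b)) =
        fun s => chartMetric m x₀ (c t) (c' t) (c' t)
          + (s * (2 * chartMetric m x₀ (c t) b (c' t))
            + s ^ 2 * chartMetric m x₀ (c t) b b) := by
      funext s
      rw [chartMetric_add_left, chartMetric_smul_left,
        chartMetric_symm x₀ (c t) (c' t) (c' t + s • b),
        chartMetric_symm x₀ (c t) b (c' t + s • b), chartMetric_add_left, chartMetric_add_left,
        chartMetric_smul_left, chartMetric_smul_left, chartMetric_symm x₀ (c t) (c' t) b]
      ring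
    rw [heq]
    have := (((hasDerivAt_id (0 : ℝ)).mul_const (2 * chartMetric m x₀ (c t) b (c' t))).add
      ((hasDerivAt_pow 2 (0 : ℝ)).mul_const (chartMetric m x₀ (c t) b b))).const_add
      (chartMetric m x₀ (c t) (c' t) (c' t))
    simpa using this
  refine hmain.congr_deriv ?_
  rw [hfst.fderiv, hsnd'.unique hsnd, ContinuousLinearMap.comp_apply,
    ContinuousLinearMap.inl_apply, ← map_add]
  simp

theorem IsGeodesic.hasDerivAt_norm_sq {γ : ℝ → M} (hγ : IsGeodesic m γ) (t₀ : ℝ) :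
    HasDerivAt (fun t => ‖(mfderiv 𝓘(ℝ, ℝ) (𝓡 m) γ t (1 : ℝ) : TangentSpace (𝓡 m) (γ t))‖ ^ 2)
      0 t₀ := by
  have : IsManifold (𝓡 m) 1 M := IsManifold.of_le (n := ∞) (by norm_cast)
  set x₀ := γ t₀ with hx₀
  set c : ℝ → 𝔼 := fun s => extChartAt (𝓡 m) x₀ (γ s) with hc
  have hs₀ : γ t₀ ∈ (chartAt 𝔼 x₀).source := mem_chart_source 𝔼 x₀
  have hU : γ ⁻¹' (chartAt 𝔼 x₀).source ∈ 𝓝 t₀ :=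
    hγ.1.continuous.continuousAt.preimage_mem_nhds
      ((chartAt 𝔼 x₀).open_source.mem_nhds (mem_chart_source 𝔼 x₀))
  have hUo : IsOpen (γ ⁻¹' (chartAt 𝔼 x₀).source) :=
    (chartAt 𝔼 x₀).open_source.preimage hγ.1.continuous
  have hcs : ∀ s ∈ γ ⁻¹' (chartAt 𝔼 x₀).source, ContDiffAt ℝ 2 c s := fun s hs => by
    have h1 : ContMDiffAt (𝓡 m) 𝓘(ℝ, 𝔼) 2 (extChartAt (𝓡 m) x₀) (γ s) :=
      (contMDiffAt_extChartAt' hs : ContMDiffAt (𝓡 m) 𝓘(ℝ, 𝔼) ∞ _ _).of_le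
        (by norm_cast)
    have h2 : ContMDiffAt 𝓘(ℝ, ℝ) (𝓡 m) 2 γ s := hγ.1.contMDiffAt.of_le
      (by norm_cast)
    exact (h1.comp s h2).contDiffAt
  have ht₀ : c t₀ ∈ (extChartAt (𝓡 m) x₀).target := mem_extChartAt_target x₀
  have hc2 := hcs t₀ hs₀
  have hd1 : HasDerivAt c (deriv c t₀) t₀ := (hc2.differentiableAt (by simp)).hasDerivAt
  have hd2 : HasDerivAt (deriv c) (deriv (deriv c) t₀) t₀ := by
    have h3 : ContDiffOn ℝ 1 (deriv c) (γ ⁻¹' (chartAt 𝔼 x₀).source) :=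
      ((contDiffOn_succ_iff_deriv_of_isOpen (n := 1) hUo).1
        (fun s hs => (hcs s hs).contDiffWithinAt)).2.2
    exact ((h3.contDiffAt hU).differentiableAt (by simp)).hasDerivAt
  have hder := hasDerivAt_chartMetric_self x₀ ht₀ hd1 hd2
  have hgeo := hγ.2 x₀ t₀ hs₀ (deriv c t₀)
  -- Testing the geodesic equation against `c'` cancels two of the three Christoffel terms; what
  -- remains is half the derivative of the squared speed.
  have hzero : fderiv ℝ (fun z => chartMetric m x₀ z (deriv c t₀) (deriv c t₀)) (c t₀)
      (deriv c t₀) + 2 * chartMetric m x₀ (c t₀) (deriv (deriv c) t₀) (deriv c t₀) = 0 := by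
    unfold chartChristoffel at hgeo
    simp only [hc] at hgeo ⊢
    linarith
  rw [hzero] at hder
  refine hder.congr_of_eventuallyEq ?_
  filter_upwards [hU] with s hs
  have hs' : γ s ∈ (extChartAt (𝓡 m) x₀).source := by simpa using hs
  have hsymm : (extChartAt (𝓡 m) x₀).symm (c s) = γ s := (extChartAt (𝓡 m) x₀).left_inv hs'
  have hev : γ =ᶠ[𝓝 s] (extChartAt (𝓡 m) x₀).symm ∘ c := by
    filter_upwards [hUo.mem_nhds hs] with u hu
    exact ((extChartAt (𝓡 m) x₀).left_inv (by simpa using hu)).symm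
  have hcd : DifferentiableAt ℝ c s := (hcs s hs).differentiableAt (by simp)
  have hsd : MDifferentiableAt (𝓡 m) (𝓡 m) (extChartAt (𝓡 m) x₀).symm (c s) :=
    ((contMDiffOn_extChartAt_symm (I := 𝓡 m) (n := 1) x₀).contMDiffAt
      ((isOpen_extChartAt_target x₀).mem_nhds
        ((extChartAt (𝓡 m) x₀).map_source hs'))).mdifferentiableAt (by simp)
  have hA : HasMFDerivAt 𝓘(ℝ, ℝ) (𝓡 m) γ s
      ((mfderiv (𝓡 m) (𝓡 m) (extChartAt (𝓡 m) x₀).symm (c s)).comp (fderiv ℝ c s)) :=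
    (hsd.hasMFDerivAt.comp s hcd.hasFDerivAt.hasMFDerivAt).congr_of_eventuallyEq hev
  have hB : (⟨γ s, mfderiv 𝓘(ℝ, ℝ) (𝓡 m) γ s (1 : ℝ)⟩ : TangentBundle (𝓡 m) M) =
      ⟨(extChartAt (𝓡 m) x₀).symm (c s),
        mfderiv (𝓡 m) (𝓡 m) (extChartAt (𝓡 m) x₀).symm (c s) (deriv c s)⟩ := by
    rw [hA.mfderiv]
    exact (tangentBundle_mk_congr hsymm _).symm
  have hC := congrArg (fun X : TangentBundle (𝓡 m) M => ‖X.2‖ ^ 2) hB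
  exact hC.trans (real_inner_self_eq_norm_sq _).symm

theorem IsGeodesic.norm_mfderiv {γ : ℝ → M} (hγ : IsGeodesic m γ) (t : ℝ) :
    ‖(mfderiv 𝓘(ℝ, ℝ) (𝓡 m) γ t (1 : ℝ) : TangentSpace (𝓡 m) (γ t))‖ =
      ‖(mfderiv 𝓘(ℝ, ℝ) (𝓡 m) γ 0 (1 : ℝ) : TangentSpace (𝓡 m) (γ 0))‖ := by
  have h := is_const_of_deriv_eq_zero (fun t => (hγ.hasDerivAt_norm_sq t).differentiableAt)
    (fun t => (hγ.hasDerivAt_norm_sq t).deriv) t 0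
  exact (sq_eq_sq₀ (norm_nonneg _) (norm_nonneg _)).1 h

theorem IsGeodesic.dist_le [IsRiemannianManifold (𝓡 m) M] {γ : ℝ → M} (hγ : IsGeodesic m γ)
    {t : ℝ} (ht : 0 ≤ t) :
    dist (γ 0) (γ t) ≤
      t * ‖(mfderiv 𝓘(ℝ, ℝ) (𝓡 m) γ 0 (1 : ℝ) : TangentSpace (𝓡 m) (γ 0))‖ := by
  have h1 : ContMDiffOn 𝓘(ℝ, ℝ) (𝓡 m) 1 γ (Icc 0 t) :=
    (hγ.1.of_le (by norm_cast)).contMDiffOn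
  have h2 := riemannianEDist_le_pathELength h1 rfl rfl ht
  rw [← IsRiemannianManifold.out, pathELength_eq_lintegral_mfderiv_Icc] at h2
  have h3 : ∀ s, ‖(mfderiv 𝓘(ℝ, ℝ) (𝓡 m) γ s (1 : ℝ) : TangentSpace (𝓡 m) (γ s))‖ₑ =
      ENNReal.ofReal ‖(mfderiv 𝓘(ℝ, ℝ) (𝓡 m) γ 0 (1 : ℝ) : TangentSpace (𝓡 m) (γ 0))‖ := by
    intro s
    rw [← ofReal_norm, hγ.norm_mfderiv s]
  have h4 := h2.trans_eq (MeasureTheory.lintegral_congr h3)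
  rw [MeasureTheory.lintegral_const, MeasureTheory.Measure.restrict_apply_univ,
    Real.volume_Icc, sub_zero] at h4
  rw [← ENNReal.ofReal_mul (norm_nonneg _), edist_dist,
    ENNReal.ofReal_le_ofReal_iff (by positivity)] at h4
  linarith


end Speed
-- Steepest descent directions and their approximations.
section Direction

variable {m n : ℕ} [NeZero n] {M : Type*} [MetricSpace M]
  [ChartedSpace (EuclideanSpace ℝ (Fin m)) M]

/-- The directional derivative `max_i ⟨∇f_i(p), v⟩`. -/
def jacMax (f : Fin n → M → ℝ) (p : M) (v : TangentSpace (𝓡 m) p) : ℝ :=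
  Finset.univ.sup' Finset.univ_nonempty (jac m f p v)

theorem jac_le_jacMax (f : Fin n → M → ℝ) (p : M) (v : TangentSpace (𝓡 m) p) (i : Fin n) :
    jac m f p v i ≤ jacMax f p v :=
  Finset.le_sup' (jac m f p v) (Finset.mem_univ i)

theorem jacMax_smul_add_smul_le (f : Fin n → M → ℝ) (p : M) (u w : TangentSpace (𝓡 m) p)
    {a b : ℝ} (ha : 0 ≤ a) (hb : 0 ≤ b) :
    jacMax f p (a • u + b • w) ≤ a * jacMax f p u + b * jacMax f p w := by
  refine Finset.sup'_le _ _ fun i _ => ?_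
  have h : jac m f p (a • u + b • w) i = a * jac m f p u i + b * jac m f p w i := by
    unfold jac
    rw [map_add, map_smul, map_smul, smul_eq_mul, smul_eq_mul]
  rw [h]
  exact add_le_add (mul_le_mul_of_nonneg_left (jac_le_jacMax f p u i) ha)
    (mul_le_mul_of_nonneg_left (jac_le_jacMax f p w i) hb)

theorem jacMax_smul_le (f : Fin n → M → ℝ) (p : M) (u : TangentSpace (𝓡 m) p)
    {a : ℝ} (ha : 0 ≤ a) : jacMax f p (a • u) ≤ a * jacMax f p u := by
  simpa using jacMax_smul_add_smul_le f p u u ha le_rfl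

theorem isParetoCritical_iff (f : Fin n → M → ℝ) (p : M) :
    IsParetoCritical m f p ↔ ∀ v : TangentSpace (𝓡 m) p, 0 ≤ jacMax f p v := by
  unfold IsParetoCritical
  push Not
  refine forall_congr' fun v => ?_
  simp [jacMax, Finset.le_sup'_iff]

variable [RiemannianBundle (fun x : M => TangentSpace (𝓡 m) x)]

theorem descentModel_eq (f : Fin n → M → ℝ) (p : M) (v : TangentSpace (𝓡 m) p) :
    descentModel m f p v = jacMax f p v + ‖v‖ ^ 2 / 2 := rfl

theorem descentModel_steepestDescent_le (f : Fin n → M → ℝ) (p : M)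
    (w : TangentSpace (𝓡 m) p) :
    descentModel m f p (steepestDescent m f p) ≤ descentModel m f p w :=
  (exists_descentModel_min m f p).choose_spec w

/-- A quadratic polynomial in `s` without constant term, nonnegative near `0` on the right, has a
nonnegative linear coefficient. -/
theorem nonneg_of_forall_mul_add_sq {a b : ℝ} (h : ∀ s : ℝ, 0 < s → s < 1 → 0 ≤ s * a + s ^ 2 * b) :
    0 ≤ a := by
  have h1 : ∀ s ∈ Ioo (0 : ℝ) 1, 0 ≤ a + s * b := fun s hs => by
    have := h s hs.1 hs.2
    have h2 : 0 ≤ s * (a + s * b) := by linarith [this, sq s, mul_assoc s s b,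
      show s * (a + s * b) = s * a + s ^ 2 * b by ring]
    exact nonneg_of_mul_nonneg_right h2 hs.1
  have h2 : Tendsto (fun s : ℝ => a + s * b) (𝓝[>] 0) (𝓝 a) := by
    have : Continuous fun s : ℝ => a + s * b := by fun_prop
    simpa using (this.tendsto 0).mono_left nhdsWithin_le_nhds
  exact ge_of_tendsto h2 (mem_of_superset (Ioo_mem_nhdsGT one_pos) h1)

/-- Compare `v` with `(1 ± s)v`: first-order optimality at scale `1` gives both inequalities. -/
theorem jacMax_steepestDescent (f : Fin n → M → ℝ) (p : M) :
    jacMax f p (steepestDescent m f p) = -‖steepestDescent m f p‖ ^ 2 := by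
  set v := steepestDescent m f p with hv
  have key : ∀ a : ℝ, 0 ≤ a →
      jacMax f p v + ‖v‖ ^ 2 / 2 ≤ a * jacMax f p v + a ^ 2 * (‖v‖ ^ 2 / 2) := fun a ha => by
    have h1 := descentModel_steepestDescent_le f p (a • v)
    rw [← hv, descentModel_eq, descentModel_eq, norm_smul, mul_pow, Real.norm_eq_abs, sq_abs] at h1
    linarith [jacMax_smul_le f p v ha]
  have h1 : 0 ≤ jacMax f p v + ‖v‖ ^ 2 :=
    nonneg_of_forall_mul_add_sq (b := ‖v‖ ^ 2 / 2) fun s hs _ => by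
      have := key (1 + s) (by linarith)
      linarith
  have h2 : 0 ≤ -(jacMax f p v + ‖v‖ ^ 2) :=
    nonneg_of_forall_mul_add_sq (b := ‖v‖ ^ 2 / 2) fun s hs hs1 => by
      have := key (1 - s) (by linarith)
      linarith
  linarith

theorem descentModel_steepestDescent (f : Fin n → M → ℝ) (p : M) :
    descentModel m f p (steepestDescent m f p) = -‖steepestDescent m f p‖ ^ 2 / 2 := by
  rw [descentModel_eq, jacMax_steepestDescent]
  ring

/-- Strong convexity of the model at its minimizer. -/
theorem norm_sub_steepestDescent_sq_le (f : Fin n → M → ℝ) (p : M) (w : TangentSpace (𝓡 m) p) :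
    ‖w - steepestDescent m f p‖ ^ 2 / 2 ≤
      descentModel m f p w - descentModel m f p (steepestDescent m f p) := by
  set v := steepestDescent m f p with hv
  have h : 0 ≤ descentModel m f p w - descentModel m f p v - ‖w - v‖ ^ 2 / 2 :=
    -- Minimality is tested at `(1 - s)v + sw`; the defect `-s(1 - s)‖w - v‖²/2` of the squared norm
    -- supplies the quadratic gain to first order in `s`.
    nonneg_of_forall_mul_add_sq (b := ‖w - v‖ ^ 2 / 2) fun s hs hs1 => by
      have h1 := descentModel_steepestDescent_le f p ((1 - s) • v + s • w)
      have h2 := jacMax_smul_add_smul_le f p v w (sub_nonneg.2 hs1.le) hs.le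
      have h3 : ‖(1 - s) • v + s • w‖ ^ 2 =
          (1 - s) * ‖v‖ ^ 2 + s * ‖w‖ ^ 2 - s * (1 - s) * ‖w - v‖ ^ 2 := by
        rw [@norm_add_sq_real, @norm_sub_sq_real, norm_smul, norm_smul, real_inner_smul_left,
          real_inner_smul_right, mul_pow, mul_pow, Real.norm_eq_abs, Real.norm_eq_abs, sq_abs,
          sq_abs, real_inner_comm]
        ring
      rw [← hv] at h1
      simp only [descentModel_eq] at h1 ⊢
      rw [h3] at h1
      linarith
  linarith

theorem steepestDescent_eq_zero_of_isParetoCritical {f : Fin n → M → ℝ} {p : M}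
    (h : IsParetoCritical m f p) : ‖steepestDescent m f p‖ = 0 := by
  have h1 := (isParetoCritical_iff f p).1 h (steepestDescent m f p)
  rw [jacMax_steepestDescent] at h1
  exact pow_eq_zero_iff two_ne_zero |>.1 (le_antisymm (by linarith) (sq_nonneg _))

/-- If `v(p) = 0`, the model is nonnegative; on short vectors its linear part dominates, forcing
criticality. -/
theorem norm_steepestDescent_pos {f : Fin n → M → ℝ} {p : M}
    (h : ¬ IsParetoCritical m f p) : 0 < ‖steepestDescent m f p‖ := by
  refine (norm_nonneg _).lt_of_ne fun h0 => h ((isParetoCritical_iff f p).2 fun v => ?_)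
  refine nonneg_of_forall_mul_add_sq (b := ‖v‖ ^ 2 / 2) fun s hs _ => ?_
  have h1 := descentModel_steepestDescent_le f p (s • v)
  rw [descentModel_steepestDescent, ← h0, descentModel_eq, norm_smul, mul_pow, Real.norm_eq_abs,
    sq_abs] at h1
  linarith [jacMax_smul_le f p v hs.le]

variable {f : Fin n → M → ℝ} {σ : ℝ} {p : M} {v : TangentSpace (𝓡 m) p}

/-- Strong convexity puts `v` within `√σ ‖v(p)‖` of `v(p)`. -/
theorem IsApproxSteepest.le_norm (hσ : 0 ≤ σ) (hv : IsApproxSteepest m f σ p v) :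
    (1 - √σ) * ‖steepestDescent m f p‖ ≤ ‖v‖ := by
  have h1 := norm_sub_steepestDescent_sq_le f p v
  unfold IsApproxSteepest at hv
  rw [descentModel_steepestDescent] at h1 hv
  have h2 : ‖v - steepestDescent m f p‖ ^ 2 ≤ (√σ * ‖steepestDescent m f p‖) ^ 2 := by
    rw [mul_pow, Real.sq_sqrt hσ]
    linarith
  have h3 := abs_le_of_sq_le_sq' h2 (by positivity) |>.2
  have h4 := norm_sub_norm_le (steepestDescent m f p) v
  rw [norm_sub_rev] at h4
  linarith

theorem IsApproxSteepest.jacMax_le (hσ : σ ≤ 1) (hv : IsApproxSteepest m f σ p v) :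
    jacMax f p v ≤ -‖v‖ ^ 2 / 2 := by
  unfold IsApproxSteepest at hv
  rw [descentModel_steepestDescent, descentModel_eq] at hv
  nlinarith [mul_nonneg (sub_nonneg.2 hσ) (sq_nonneg ‖steepestDescent m f p‖)]

end Direction

/-! ### The merit function and weak Pareto optima. -/

section Merit

theorem isWeakPareto_of_exists_le {n : ℕ} {M : Type*} {f : Fin n → M → ℝ} {pbar : M}
    (h : ∀ q, ∃ i, f i pbar ≤ f i q) : IsWeakPareto f pbar := by
  rintro ⟨q, hq, -⟩
  obtain ⟨i, hi⟩ := h q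
  exact (hq i).not_ge hi

variable {n : ℕ} [NeZero n] {M : Type*} {f : Fin n → M → ℝ} {pbar : M}

theorem IsWeakPareto.exists_le (h : IsWeakPareto f pbar) (q : M) : ∃ i, f i pbar ≤ f i q := by
  by_contra! hc
  refine h ⟨q, hc, fun he => ?_⟩
  exact (hc 0).ne (congrFun he 0)

theorem inf'_sub_le_of_isWeakPareto (h : IsWeakPareto f pbar) {p : M} {C : ℝ}
    (hC : ∀ i, f i p ≤ f i pbar + C) (q : M) :
    (Finset.univ.inf' Finset.univ_nonempty fun i => f i p - f i q) ≤ C := by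
  obtain ⟨i, hi⟩ := h.exists_le q
  exact (Finset.inf'_le _ (Finset.mem_univ i)).trans (by linarith [hC i])

/-- An unbounded real `⨆` defaults to `0`, so comparing a single `q` with the supremum needs this
bound. -/
theorem bddAbove_merit (h : IsWeakPareto f pbar) (p : M) :
    BddAbove (range fun q : M =>
      Finset.univ.inf' Finset.univ_nonempty fun i => f i p - f i q) := by
  refine ⟨Finset.univ.sup' Finset.univ_nonempty fun i => f i p - f i pbar, ?_⟩
  rintro _ ⟨q, rfl⟩
  refine inf'_sub_le_of_isWeakPareto h (fun i => ?_) q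
  linarith [Finset.le_sup' (fun i => f i p - f i pbar) (Finset.mem_univ i)]

theorem le_merit (h : IsWeakPareto f pbar) (p q : M) :
    (Finset.univ.inf' Finset.univ_nonempty fun i => f i p - f i q) ≤ merit f p :=
  le_ciSup (bddAbove_merit h p) q

theorem merit_nonneg (h : IsWeakPareto f pbar) (p : M) : 0 ≤ merit f p := by
  refine le_trans ?_ (le_merit h p p)
  simp

theorem merit_le_of_isWeakPareto (h : IsWeakPareto f pbar) {p : M} {C : ℝ}
    (hC : ∀ i, f i p ≤ f i pbar + C) : merit f p ≤ C :=
  have : Nonempty M := ⟨p⟩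
  ciSup_le (inf'_sub_le_of_isWeakPareto h hC)

theorem merit_add_le (h : IsWeakPareto f pbar) {p p' : M} {C : ℝ}
    (hC : ∀ i, f i p' + C ≤ f i p) : merit f p' + C ≤ merit f p := by
  have : Nonempty M := ⟨p⟩
  suffices merit f p' ≤ merit f p - C by linarith
  refine ciSup_le fun q => ?_
  have h1 := le_merit h p q
  suffices (Finset.univ.inf' Finset.univ_nonempty fun i => f i p' - f i q) + C ≤
      Finset.univ.inf' Finset.univ_nonempty fun i => f i p - f i q by linarith
  refine Finset.le_inf' _ _ fun i _ => ?_
  linarith [hC i, Finset.inf'_le (fun i => f i p' - f i q) (Finset.mem_univ i)]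

theorem isWeakPareto_of_merit_eq_zero {p : M} (hpbar : IsWeakPareto f pbar)
    (hp : merit f p = 0) : IsWeakPareto f p := by
  refine isWeakPareto_of_exists_le fun q => ?_
  have h1 := le_merit hpbar p q
  obtain ⟨i, -, hi⟩ := Finset.exists_mem_eq_inf' Finset.univ_nonempty (fun i => f i p - f i q)
  rw [hi, hp] at h1
  exact ⟨i, by linarith⟩

/-- Continuity of `merit` is not needed: the limit is taken for each fixed `q`. -/
theorem isWeakPareto_of_tendsto [TopologicalSpace M] (h : IsWeakPareto f pbar)
    (hf : ∀ i, Continuous (f i)) {p : ℕ → M} {a : M} (hp : Tendsto p atTop (𝓝 a))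
    (hm : Tendsto (fun k => merit f (p k)) atTop (𝓝 0)) : IsWeakPareto f a := by
  refine isWeakPareto_of_exists_le fun q => ?_
  have hc : Continuous fun x : M => Finset.univ.inf' Finset.univ_nonempty
      fun i => f i x - f i q :=
    Continuous.finset_inf'_apply _ fun i _ => (hf i).sub continuous_const
  have h1 := le_of_tendsto_of_tendsto' ((hc.tendsto a).comp hp) hm fun k => le_merit h (p k) q
  obtain ⟨i, -, hi⟩ := Finset.exists_mem_eq_inf' Finset.univ_nonempty (fun i => f i a - f i q)
  rw [hi] at h1
  exact ⟨i, by linarith⟩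

theorem exists_merit_lt [PseudoMetricSpace M] (h : IsWeakPareto f pbar)
    (hf : ∀ i, Continuous (f i)) {ε : ℝ} (hε : 0 < ε) :
    ∃ δ > 0, ∀ p ∈ Metric.closedBall pbar δ, merit f p ≤ ε := by
  have h1 : ∀ᶠ p in 𝓝 pbar, ∀ i, f i p < f i pbar + ε :=
    eventually_all.2 fun i => (hf i).continuousAt.eventually_lt continuousAt_const (by linarith)
  obtain ⟨δ, hδ, hsub⟩ := Metric.nhds_basis_closedBall.eventually_iff.1 h1
  exact ⟨δ, hδ, fun p hp => merit_le_of_isWeakPareto h fun i => (hsub hp i).le⟩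

end Merit

/-! ### Estimates for a single step. -/

section Step

variable {m n : ℕ} [NeZero n] {M : Type*} [MetricSpace M]
  [ChartedSpace (EuclideanSpace ℝ (Fin m)) M]
  [RiemannianBundle (fun x : M => TangentSpace (𝓡 m) x)]
  {f : Fin n → M → ℝ} {σ β R t : ℝ} {p p' pbar : M} {v : TangentSpace (𝓡 m) p}

theorem IsStep.merit_add_le (hpbar : IsWeakPareto f pbar) (hσ : σ ≤ 1) (hβ : 0 ≤ β)
    (h : IsStep m f σ β R p v t p') :
    merit f p' + β * t * (‖v‖ ^ 2 / 2) ≤ merit f p := by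
  obtain ⟨hs, ht, γ, -, -, hd, rfl⟩ := h
  refine MultiobjDescent.merit_add_le hpbar fun i => ?_
  have h1 := (jac_le_jacMax f p v i).trans (hs.jacMax_le hσ)
  have h2 := mul_le_mul_of_nonneg_left h1 (mul_nonneg hβ ht.1.le)
  linarith [hd i]

theorem IsStep.merit_le_mul (h : IsStep m f σ β R p v t p')
    (hpbar : IsWeakPareto f pbar) (hσ : σ ∈ Ioo 0 1) (hβ : 0 < β) {α : ℝ}
    (hKL : α * merit f p ≤ ‖steepestDescent m f p‖ ^ 2) :
    merit f p' ≤ (1 - α * β * t * (1 - √σ) ^ 2 / 2) * merit f p := by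
  have hσ1 : 0 < 1 - √σ := sub_pos.2 ((Real.sqrt_lt' one_pos).2 (by simpa using hσ.2))
  have hdec := h.merit_add_le hpbar hσ.2.le hβ.le
  have ht := h.2.1.1
  have h1 : (1 - √σ) ^ 2 * (α * merit f p) ≤ ‖v‖ ^ 2 := by
    refine (mul_le_mul_of_nonneg_left hKL (sq_nonneg _)).trans ?_
    rw [← mul_pow]
    exact pow_le_pow_left₀ (by positivity) (h.1.le_norm hσ.1.le) 2
  have h2 := mul_le_mul_of_nonneg_left h1 (mul_nonneg hβ.le ht.le)
  linarith

/-- The step strictly lowers a nonnegative quantity. -/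
theorem IsStep.merit_pos (h : IsStep m f σ β R p v t p') (hp : ¬ IsParetoCritical m f p)
    (hpbar : IsWeakPareto f pbar) (hσ : σ ∈ Ioo 0 1) (hβ : 0 < β) : 0 < merit f p := by
  have hσ1 : 0 < 1 - √σ := sub_pos.2 ((Real.sqrt_lt' one_pos).2 (by simpa using hσ.2))
  have hdec := h.merit_add_le hpbar hσ.2.le hβ.le
  have hm := merit_nonneg hpbar p'
  have ht := h.2.1.1
  have hv : 0 < ‖v‖ := (mul_pos hσ1 (norm_steepestDescent_pos hp)).trans_le (h.1.le_norm hσ.1.le)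
  have : 0 < β * t * (‖v‖ ^ 2 / 2) := by positivity
  linarith

variable [IsManifold (𝓡 m) ∞ M]
  [IsContMDiffRiemannianBundle (𝓡 m) ∞ (EuclideanSpace ℝ (Fin m))
    (fun x : M => TangentSpace (𝓡 m) x)]
  [IsRiemannianManifold (𝓡 m) M]

theorem IsStep.dist_le (h : IsStep m f σ β R p v t p') : dist p p' ≤ t * ‖v‖ := by
  obtain ⟨-, ht, γ, hγ, hv, -, rfl⟩ := h
  have h1 := hγ.dist_le ht.1.le
  have h2 : γ 0 = p := congrArg (fun X : TangentBundle (𝓡 m) M => X.1) hv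
  have h3 := congrArg (fun X : TangentBundle (𝓡 m) M => ‖X.2‖) hv
  have h4 : ‖(mfderiv 𝓘(ℝ, ℝ) (𝓡 m) γ 0 (1 : ℝ) : TangentSpace (𝓡 m) (γ 0))‖ = ‖v‖ := h3
  rwa [h4, h2] at h1

/-- A bound of the step by the decrease of the square root of the merit function, independent of
the step size. -/
theorem IsStep.dist_le_sqrt_merit_sub (h : IsStep m f σ β R p v t p')
    (hpbar : IsWeakPareto f pbar) (hσ : σ ∈ Ioo 0 1) (hβ : 0 < β) {α : ℝ} (hα : 0 < α)
    (hKL : α * merit f p ≤ ‖steepestDescent m f p‖ ^ 2) :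
    dist p p' ≤ 4 / (β * ((1 - √σ) * √α)) * (√(merit f p) - √(merit f p')) := by
  have hσ1 : 0 < 1 - √σ := sub_pos.2 ((Real.sqrt_lt' one_pos).2 (by simpa using hσ.2))
  have hκ : 0 < (1 - √σ) * √α := mul_pos hσ1 (Real.sqrt_pos.2 hα)
  have hv : (1 - √σ) * √α * √(merit f p) ≤ ‖v‖ := by
    refine le_trans ?_ (h.1.le_norm hσ.1.le)
    rw [mul_assoc, ← Real.sqrt_mul hα.le]
    exact mul_le_mul_of_nonneg_left
      ((Real.sqrt_le_sqrt hKL).trans_eq (Real.sqrt_sq (norm_nonneg _))) hσ1.le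
  have hdec := h.merit_add_le hpbar hσ.2.le hβ.le
  have hsq := Real.sq_sqrt (merit_nonneg hpbar p)
  have hsq' := Real.sq_sqrt (merit_nonneg hpbar p')
  have hd := h.dist_le
  have ht := h.2.1.1
  set κ := (1 - √σ) * √α
  set a := √(merit f p)
  set b := √(merit f p')
  have ha : 0 ≤ a := Real.sqrt_nonneg _
  have hb : 0 ≤ b := Real.sqrt_nonneg _
  have hx : 0 ≤ t * ‖v‖ := by positivity
  have hab : b ≤ a := abs_le_of_sq_le_sq'
    (by nlinarith [mul_nonneg (mul_nonneg hβ.le ht.le) (sq_nonneg ‖v‖)]) ha |>.2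
  refine hd.trans ?_
  rw [div_mul_eq_mul_div, le_div_iff₀ (mul_pos hβ hκ)]
  -- The main case divides by `a`; if `a = 0`, no decrease is possible, so `v = 0`.
  rcases ha.eq_or_lt with h0 | hapos
  · have hb0 : b = 0 := le_antisymm (h0 ▸ hab) hb
    rw [← hsq, ← hsq', ← h0, hb0] at hdec
    have hv0 : ‖v‖ = 0 := by
      by_contra hne
      have : 0 < β * t * (‖v‖ ^ 2 / 2) := by positivity
      linarith
    rw [hv0, ← h0, hb0]
    simp
  · have h1 : t * ‖v‖ * (κ * a) ≤ t * ‖v‖ * ‖v‖ := mul_le_mul_of_nonneg_left hv hx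
    -- The merit decrease `βt‖v‖² ≤ 2(a² - b²)` and `a + b ≤ 2a` produce the constant `4`.
    have h2 : t * ‖v‖ * (β * κ) * a ≤ 4 * (a - b) * a := by
      have h3 : β * (t * ‖v‖ * (κ * a)) ≤ β * (t * ‖v‖ * ‖v‖) :=
        mul_le_mul_of_nonneg_left h1 hβ.le
      nlinarith [mul_nonneg (sub_nonneg.2 hab) (sub_nonneg.2 hab)]
    exact le_of_mul_le_mul_right h2 hapos

/-- From `(t‖v‖)² ≤ R·t‖v‖²` and the merit decrease. -/
theorem IsStep.dist_le_sqrt_mul_sqrt_merit (h : IsStep m f σ β R p v t p')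
    (hpbar : IsWeakPareto f pbar) (hσ : σ ≤ 1) (hβ : 0 < β) :
    dist p p' ≤ √(2 * R / β) * √(merit f p) := by
  have hdec := h.merit_add_le hpbar hσ hβ.le
  have hm := merit_nonneg hpbar p'
  have ht := h.2.1.1
  have htR := h.2.1.2
  have hR : 0 < R := ht.trans_le htR
  refine h.dist_le.trans ?_
  rw [← Real.sqrt_mul (by positivity)]
  refine Real.le_sqrt_of_sq_le ?_
  rw [div_mul_eq_mul_div, le_div_iff₀ hβ]
  have h1 : (t * ‖v‖) ^ 2 * β = t * (β * t * ‖v‖ ^ 2) := by ring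
  rw [h1]
  have h2 : t * (β * t * ‖v‖ ^ 2) ≤ R * (β * t * ‖v‖ ^ 2) :=
    mul_le_mul_of_nonneg_right htR (by positivity)
  nlinarith

end Step

/-! ### Contraction and confinement of generated sequences. -/

section Sequence

variable {m n : ℕ} [NeZero n] {M : Type*} [MetricSpace M]
  [ChartedSpace (EuclideanSpace ℝ (Fin m)) M]
  [RiemannianBundle (fun x : M => TangentSpace (𝓡 m) x)]
  {f : Fin n → M → ℝ} {σ β R α r : ℝ} {pbar : M} {p : ℕ → M}
  {v : ∀ k, TangentSpace (𝓡 m) (p k)} {t : ℕ → ℝ}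

theorem IsGenerated.eq_of_isParetoCritical (h : IsGenerated m f σ β R p v t)
    (h0 : IsParetoCritical m f (p 0)) (k : ℕ) : p k = p 0 := by
  induction k with
  | zero => rfl
  | succ k ih => rw [(h k).1 (ih ▸ h0), ih]

theorem merit_eq_zero_of_isParetoCritical {p : M} (hpbar : IsWeakPareto f pbar) (hα : 0 < α)
    (hKL : α * merit f p ≤ ‖steepestDescent m f p‖ ^ 2) (hp : IsParetoCritical m f p) :
    merit f p = 0 := by
  rw [steepestDescent_eq_zero_of_isParetoCritical hp] at hKL
  have := merit_nonneg hpbar p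
  nlinarith

theorem IsGenerated.bddBelow (h : IsGenerated m f σ β R p v t) :
    BddBelow (range fun k : {k : ℕ // ¬ IsParetoCritical m f (p k)} => t k) :=
  ⟨0, by rintro _ ⟨k, rfl⟩; exact ((h k).2 k.2).2.1.1.le⟩

theorem IsGenerated.stepInf_le (h : IsGenerated m f σ β R p v t) {k : ℕ}
    (hk : ¬ IsParetoCritical m f (p k)) : stepInf m f p t ≤ t k :=
  ciInf_le h.bddBelow (⟨k, hk⟩ : {k : ℕ // ¬ IsParetoCritical m f (p k)})

theorem IsGenerated.merit_succ_le (h : IsGenerated m f σ β R p v t)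
    (hpbar : IsWeakPareto f pbar) (hσ : σ ∈ Ioo 0 1) (hβ : 0 < β) (hα : 0 < α) {k : ℕ}
    (hKL : α * merit f (p k) ≤ ‖steepestDescent m f (p k)‖ ^ 2) :
    merit f (p (k + 1)) ≤
      (1 - α * β * stepInf m f p t * (1 - √σ) ^ 2 / 2) * merit f (p k) := by
  by_cases hk : IsParetoCritical m f (p k)
  · rw [(h k).1 hk, merit_eq_zero_of_isParetoCritical hpbar hα hKL hk, mul_zero]
  · refine (((h k).2 hk).merit_le_mul hpbar hσ hβ hKL).trans ?_
    refine mul_le_mul_of_nonneg_right ?_ (merit_nonneg hpbar _)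
    have h1 : α * β * (1 - √σ) ^ 2 / 2 * stepInf m f p t ≤ α * β * (1 - √σ) ^ 2 / 2 * t k :=
      mul_le_mul_of_nonneg_left (h.stepInf_le hk) (by positivity)
    linarith

/-- The factor carries `φ(p_0) > 0` to an upper bound of `φ(p_1) ≥ 0`, so it cannot be negative. -/
theorem IsGenerated.zero_le_one_sub (h : IsGenerated m f σ β R p v t)
    (hpbar : IsWeakPareto f pbar) (hσ : σ ∈ Ioo 0 1) (hβ : 0 < β) (hα : 0 < α)
    (hKL : α * merit f (p 0) ≤ ‖steepestDescent m f (p 0)‖ ^ 2)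
    (h0 : ¬ IsParetoCritical m f (p 0)) :
    0 ≤ 1 - α * β * stepInf m f p t * (1 - √σ) ^ 2 / 2 :=
  nonneg_of_mul_nonneg_left
    ((merit_nonneg hpbar _).trans (h.merit_succ_le hpbar hσ hβ hα hKL))
    (((h 0).2 h0).merit_pos h0 hpbar hσ hβ)

variable [IsManifold (𝓡 m) ∞ M]
  [IsContMDiffRiemannianBundle (𝓡 m) ∞ (EuclideanSpace ℝ (Fin m))
    (fun x : M => TangentSpace (𝓡 m) x)]
  [IsRiemannianManifold (𝓡 m) M]

theorem IsGenerated.mem_closedBall (h : IsGenerated m f σ β R p v t)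
    (hpbar : IsWeakPareto f pbar) (hσ : σ ∈ Ioo 0 1) (hβ : 0 < β) (hα : 0 < α)
    (hKL : ∀ q ∈ Metric.closedBall pbar r, α * merit f q ≤ ‖steepestDescent m f q‖ ^ 2)
    (h0 : dist (p 0) pbar + 4 / (β * ((1 - √σ) * √α)) * √(merit f (p 0)) ≤ r) (k : ℕ) :
    p k ∈ Metric.closedBall pbar r := by
  have hσ1 : 0 < 1 - √σ := sub_pos.2 ((Real.sqrt_lt' one_pos).2 (by simpa using hσ.2))
  set K := 4 / (β * ((1 - √σ) * √α)) with hK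
  have hKnn : 0 ≤ K := by positivity
  have hball : ∀ k, dist (p k) pbar + K * √(merit f (p k)) ≤ r →
      p k ∈ Metric.closedBall pbar r := fun k hk =>
    Metric.mem_closedBall.2 (by linarith [mul_nonneg hKnn (Real.sqrt_nonneg (merit f (p k)))])
  -- The left side does not increase along steps started in the ball: `√φ` pays for the distance
  -- travelled.
  suffices hmain : dist (p k) pbar + K * √(merit f (p k)) ≤ r from hball k hmain
  induction k with
  | zero => exact h0
  | succ k ih =>
    by_cases hk : IsParetoCritical m f (p k)
    · rwa [(h k).1 hk]
    · have h1 := ((h k).2 hk).dist_le_sqrt_merit_sub hpbar hσ hβ hα (hKL _ (hball k ih))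
      rw [← hK, dist_comm] at h1
      linarith [dist_triangle (p (k + 1)) (p k) pbar]

theorem IsGenerated.dist_succ_le (h : IsGenerated m f σ β R p v t)
    (hpbar : IsWeakPareto f pbar) (hσ : σ ≤ 1) (hβ : 0 < β) (k : ℕ) :
    dist (p k) (p (k + 1)) ≤ √(2 * R / β) * √(merit f (p k)) := by
  by_cases hk : IsParetoCritical m f (p k)
  · rw [(h k).1 hk, dist_self]
    positivity
  · exact ((h k).2 hk).dist_le_sqrt_mul_sqrt_merit hpbar hσ hβ

end Sequence

/-- If the merit values decay like `ρ ^ (2 * k)` and dominate the squares of the steps, then the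
sequence converges and its distance to the limit is controlled by the merit values. -/
theorem exists_tendsto_of_geometric {X : Type*} [MetricSpace X] [CompleteSpace X] {x : ℕ → X}
    {φ : ℕ → ℝ} {A ρ : ℝ} (hA : 0 ≤ A) (hρ : 0 ≤ ρ) (hρ1 : ρ < 1)
    (hφ : ∀ k, φ (k + 1) ≤ ρ ^ 2 * φ k) (hx : ∀ k, dist (x k) (x (k + 1)) ≤ A * √(φ k)) :
    ∃ a, Tendsto x atTop (𝓝 a) ∧ ∀ k, dist (x k) a ≤ A * √(φ k) / (1 - ρ) := by
  have hsqrt : ∀ k j, √(φ (k + j)) ≤ √(φ k) * ρ ^ j := fun k j => by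
    induction j with
    | zero => simp
    | succ j ih =>
      have h1 : √(φ (k + (j + 1))) ≤ ρ * √(φ (k + j)) := by
        refine (Real.sqrt_le_sqrt (hφ (k + j))).trans_eq ?_
        rw [Real.sqrt_mul (sq_nonneg ρ), Real.sqrt_sq hρ]
      calc _ ≤ _ := h1
        _ ≤ ρ * (√(φ k) * ρ ^ j) := mul_le_mul_of_nonneg_left ih hρ
        _ = _ := by ring
  have hgeo : ∀ k j, dist (x (k + j)) (x (k + (j + 1))) ≤ A * √(φ k) * ρ ^ j := fun k j => by
    refine (hx (k + j)).trans ?_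
    rw [mul_assoc]
    exact mul_le_mul_of_nonneg_left (hsqrt k j) hA
  have hcauchy : CauchySeq x := cauchySeq_of_le_geometric ρ (A * √(φ 0)) hρ1 fun j => by
    simpa using hgeo 0 j
  obtain ⟨a, ha⟩ := cauchySeq_tendsto_of_complete hcauchy
  refine ⟨a, ha, fun k => ?_⟩
  have hshift : Tendsto (fun j => x (k + j)) atTop (𝓝 a) := by
    simpa only [add_comm k] using (tendsto_add_atTop_iff_nat k).2 ha
  simpa using dist_le_of_le_geometric_of_tendsto₀ ρ (A * √(φ k)) hρ1 (hgeo k) hshift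

end MultiobjDescent

end

/-! ### The convergence theorem. -/

open MultiobjDescent in
theorem theorem4p1 {m n : ℕ} [NeZero n] {M : Type*} [MetricSpace M] [ConnectedSpace M]
    [CompleteSpace M] [ChartedSpace (EuclideanSpace ℝ (Fin m)) M] [IsManifold (𝓡 m) ∞ M]
    [RiemannianBundle (fun x : M => TangentSpace (𝓡 m) x)]
    [IsContMDiffRiemannianBundle (𝓡 m) ∞ (EuclideanSpace ℝ (Fin m))
      (fun x : M => TangentSpace (𝓡 m) x)]
    [IsRiemannianManifold (𝓡 m) M]
    (f : Fin n → M → ℝ) (hf : ∀ i, ContMDiff (𝓡 m) 𝓘(ℝ, ℝ) 1 (f i))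
    (σ β R : ℝ) (hσ : σ ∈ Set.Ioo 0 1) (hβ : β ∈ Set.Ioo 0 1) (hR : 1 ≤ R)
    (pbar : M) (hpbar : IsWeakPareto f pbar)
    (α r : ℝ) (hα : 0 < α) (hr : 0 < r)
    (hKL : ∀ p ∈ Metric.closedBall pbar r, α * merit f p ≤ ‖steepestDescent m f p‖ ^ 2) :
    ∃ δ > 0, ∀ (p : ℕ → M) (v : ∀ k, TangentSpace (𝓡 m) (p k)) (t : ℕ → ℝ),
      IsGenerated m f σ β R p v t →
      p 0 ∈ Metric.closedBall pbar δ →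
      (¬ IsParetoCritical m f (p 0) → 0 < stepInf m f p t) →
      (∀ k, p k ∈ Metric.closedBall pbar r) ∧
      ∃ pstar : M, IsWeakPareto f pstar ∧ ConvergesLinearly p pstar ∧
        (¬ IsParetoCritical m f (p 0) →
          0 ≤ 1 - α * β * stepInf m f p t * (1 - √σ) ^ 2 / 2 ∧
          rate α β σ (stepInf m f p t) < 1 ∧
          ∀ k,
            dist (p k) pstar ^ 2 ≤
                distConst R β (rate α β σ (stepInf m f p t)) * merit f (p k) ∧
              distConst R β (rate α β σ (stepInf m f p t)) * merit f (p k) ≤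
                distConst R β (rate α β σ (stepInf m f p t)) *
                  rate α β σ (stepInf m f p t) ^ (2 * k) * merit f (p 0)) := by
  have hσ1 : 0 < 1 - √σ := sub_pos.2 ((Real.sqrt_lt' one_pos).2 (by simpa using hσ.2))
  set K := 4 / (β * ((1 - √σ) * √α)) with hK
  have hβ0 : 0 < β := hβ.1
  have hKpos : 0 < K := by positivity
  -- This `ε` makes `K√φ(p_0) ≤ r/2`; the other half of `r` is left for the distance from `p_0` to
  -- `pbar`.
  obtain ⟨δ, hδ, hmerit⟩ := exists_merit_lt hpbar (fun i => (hf i).continuous)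
    (ε := (r / (2 * K)) ^ 2) (by positivity)
  refine ⟨min δ (r / 2), by positivity, fun p v t hgen hp0 hinf => ?_⟩
  have hp0' := Metric.mem_closedBall.1 hp0
  have hstart : dist (p 0) pbar + K * √(merit f (p 0)) ≤ r := by
    have h1 := Real.sqrt_le_sqrt (hmerit (p 0)
      (Metric.mem_closedBall.2 (hp0'.trans (min_le_left _ _))))
    rw [Real.sqrt_sq (by positivity)] at h1
    have h2 : K * √(merit f (p 0)) ≤ K * (r / (2 * K)) := mul_le_mul_of_nonneg_left h1 hKpos.le
    have h3 : K * (r / (2 * K)) = r / 2 := by field_simp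
    linarith [hp0'.trans (min_le_right _ _)]
  have hball := hgen.mem_closedBall hpbar hσ hβ0 hα hKL hstart
  refine ⟨hball, ?_⟩
  -- With no step made, the real infimum defaults to `0` instead of `+∞`; the sequence is then
  -- constant and the error bound forces `φ(p_0) = 0`.
  by_cases hcrit : IsParetoCritical m f (p 0)
  · have hconst := hgen.eq_of_isParetoCritical hcrit
    refine ⟨p 0, isWeakPareto_of_merit_eq_zero hpbar
      (merit_eq_zero_of_isParetoCritical hpbar hα (hKL _ (hball 0)) hcrit), ⟨?_, 0, 0, le_rfl,
      one_pos, fun k => by simp [hconst k]⟩, fun h => absurd hcrit h⟩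
    exact tendsto_const_nhds.congr fun k => (hconst k).symm
  have hnn := hgen.zero_le_one_sub hpbar hσ hβ0 hα (hKL _ (hball 0)) hcrit
  have hdecay := fun k => hgen.merit_succ_le hpbar hσ hβ0 hα (hKL _ (hball k))
  have hτ := hinf hcrit
  set ρ := rate α β σ (stepInf m f p t) with hρ
  have hρsq : ρ ^ 2 = 1 - α * β * stepInf m f p t * (1 - √σ) ^ 2 / 2 := Real.sq_sqrt hnn
  have hρ0 : 0 ≤ ρ := Real.sqrt_nonneg _
  have hρ1 : ρ < 1 := by
    refine (Real.sqrt_lt' one_pos).2 ?_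
    have : 0 < α * β * stepInf m f p t * (1 - √σ) ^ 2 / 2 := by positivity
    linarith
  have h1ρ : 0 < 1 - ρ := sub_pos.2 hρ1
  rw [← hρsq] at hdecay
  have hpow : ∀ k, merit f (p k) ≤ ρ ^ (2 * k) * merit f (p 0) := fun k => by
    induction k with
    | zero => simp
    | succ k ih =>
      calc _ ≤ _ := hdecay k
        _ ≤ ρ ^ 2 * (ρ ^ (2 * k) * merit f (p 0)) := mul_le_mul_of_nonneg_left ih (sq_nonneg ρ)
        _ = _ := by ring
  obtain ⟨pstar, hlim, hdist⟩ := exists_tendsto_of_geometric (Real.sqrt_nonneg (2 * R / β)) hρ0 hρ1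
    hdecay (hgen.dist_succ_le hpbar hσ.2.le hβ0)
  have hmerit0 : Tendsto (fun k => merit f (p k)) atTop (𝓝 0) := by
    have h1 : Tendsto (fun k : ℕ => ρ ^ (2 * k) * merit f (p 0)) atTop (𝓝 0) := by
      simp_rw [pow_mul]
      simpa using (tendsto_pow_atTop_nhds_zero_of_lt_one (sq_nonneg ρ)
        (pow_lt_one₀ hρ0 hρ1 two_ne_zero)).mul_const (merit f (p 0))
    exact squeeze_zero (fun k => merit_nonneg hpbar _) hpow h1
  refine ⟨pstar, isWeakPareto_of_tendsto hpbar (fun i => (hf i).continuous) hlim hmerit0,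
    ⟨hlim, √(2 * R / β) * √(merit f (p 0)) / (1 - ρ), ρ, hρ0, hρ1, fun k => ?_⟩,
    fun _ => ⟨hnn, hρ1, fun k => ⟨?_, ?_⟩⟩⟩
  · have h1 : √(merit f (p k)) ≤ ρ ^ k * √(merit f (p 0)) := by
      refine (Real.sqrt_le_sqrt (hpow k)).trans_eq ?_
      rw [mul_comm 2 k, pow_mul, Real.sqrt_mul (sq_nonneg _), Real.sqrt_sq (pow_nonneg hρ0 k)]
    calc _ ≤ _ := hdist k
      _ ≤ √(2 * R / β) * (ρ ^ k * √(merit f (p 0))) / (1 - ρ) := by gcongr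
      _ = _ := by ring
  · have h1 := pow_le_pow_left₀ dist_nonneg (hdist k) 2
    rw [div_pow, mul_pow, Real.sq_sqrt (by positivity), Real.sq_sqrt (merit_nonneg hpbar _)] at h1
    refine h1.trans_eq ?_
    unfold distConst
    field_simp
  · rw [mul_assoc]
    refine mul_le_mul_of_nonneg_left (hpow k) ?_
    unfold distConst
    positivity
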